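/- Let $H$ be a real Hilbert space and let $f\colon H\to\left]-\infty,+\infty\right]$ be a proper, convex, lower semicontinuous function with domain $\operatorname{dom} f=\{x : f(x)<+\infty\}$, subdifferential $\partial f$ and conjugate $f^*(u)=\sup_{x\in H}(\langle x,u\rangle-f(x))$. Suppose that $f$ is Legendre, that is: (i) $f$ is essentially smooth: $\operatorname{dom}\partial f=\operatorname{int}\operatorname{dom} f\neq\varnothing$, $f$ is Gâteaux differentiable on $\operatorname{int}\operatorname{dom} f$, and $\|\nabla f(x_k)\|\to+\infty$ for every sequence $(x_k)$ in $\operatorname{int}\operatorname{dom} f$ that converges to a boundary point of $\operatorname{dom} f$; (ii) $f$ is essentially strictly convex: $(\partial f)^{-1}$ is locally bounded on its domain, and $f$ is strictly convex on every convex subset of $\operatorname{dom}\partial f$. For $y\in\operatorname{int}\operatorname{dom} f$ and $x\in H$ let $D_f(x,y)=f(x)-f(y)-\langle\nabla f(y),x-y\rangle$ be the Bregman distance. Let $m\ge 0$, let $p_0,\dots,p_m\in\operatorname{dom} f$ be affinely independent, put $\mathcal S=\{p_0,\dots,p_m\}$, and suppose that $\operatorname{aff}(\mathcal S)\subseteq\operatorname{int}\operatorname{dom}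 f^*$. The forward Bregman pseudo-circumcenter set of $\mathcal S$ is $$\overrightarrow{CC}^{ps}_f(\mathcal S)=\nabla f^*(\operatorname{aff}\mathcal S)\cap\{q\in\operatorname{int}\operatorname{dom} f : D_f(p_0,q)=D_f(p_1,q)=\dots=D_f(p_m,q)\}.$$ Let $\eta_i=f(p_i)-f(p_0)$ for $i=1,\dots,m$, and let $G=\big(\langle p_i-p_0,\,p_j-p_0\rangle\big)_{i,j=1}^m$ be the Gram matrix of $p_1-p_0,\dots,p_m-p_0$. Then $G$ is invertible and, with $$\begin{pmatrix}\alpha_1\\ \vdots\\ \alpha_m\end{pmatrix}=G^{-1}\begin{pmatrix}\eta_1-\langle p_0,p_1-p_0\rangle\\ \vdots\\ \eta_m-\langle p_0,p_m-p_0\rangle\end{pmatrix},$$ the conjugate $f^*$ is Gâteaux differentiable at $p_0+\sum_{i=1}^m\alpha_i(p_i-p_0)$, the set $\overrightarrow{CC}^{ps}_f(\mathcal S)$ is nonempty, and $$\overrightarrow{CC}^{ps}_f(\mathcal S)=\Big\{\nabla f^*\Big(p_0+\sum_{i=1}^m\alpha_i(p_i-p_0)\Big)\Big\}.$$ -/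

import Mathlib

/-! Extended-real-valued convex functions on a real Hilbert space, Legendre functions, Bregman
distances and forward Bregman pseudo-circumcenters. -/

namespace Bregman

variable {H : Type*} [NormedAddCommGroup H] [InnerProductSpace ℝ H]

/-- The (effective) domain of an extended-real-valued function. -/
def dom (f : H → EReal) : Set H := {x | f x < ⊤}

/-- The class `Γ₀(H)`: proper, lower semicontinuous (closed), convex functions
`H → ]-∞, +∞]`; convexity is convexity of the epigraph. -/
structure IsGammaZero (f : H → EReal) : Prop where
  ne_bot : ∀ x, f x ≠ ⊥
  dom_nonempty : (dom f).Nonempty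
  convex_epigraph : Convex ℝ {z : H × ℝ | f z.1 ≤ (z.2 : EReal)}
  lowerSemicontinuous : LowerSemicontinuous f

/-- The Fenchel conjugate `f*(u) = sup_x (⟨x, u⟩ - f x)`. -/
noncomputable def conjugate (f : H → EReal) (u : H) : EReal :=
  ⨆ x : H, ((inner ℝ x u : ℝ) : EReal) - f x

/-- The convex subdifferential `∂f(x)`. -/
def subdifferential (f : H → EReal) (x : H) : Set H :=
  {u | ∀ y : H, ((inner ℝ (y - x) u : ℝ) : EReal) + f x ≤ f y}

/-- The domain of a set-valued operator. -/
def opDom (A : H → Set H) : Set H := {x | (A x).Nonempty}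

/-- The inverse of a set-valued operator. -/
def opInv (A : H → Set H) (u : H) : Set H := {x | u ∈ A x}

/-- A set-valued operator is locally bounded at `x` if the image of some closed ball of positive
radius around `x` is bounded. -/
def LocallyBoundedAt (A : H → Set H) (x : H) : Prop :=
  ∃ δ : ℝ, 0 < δ ∧ Bornology.IsBounded (⋃ z ∈ Metric.closedBall x δ, A z)

/-- `g` is the Gâteaux gradient of `f` at the point `x` of `int dom f`. For a function that never
takes the value `⊥`, the real-valued function used here agrees with `f` near `x`. -/
def HasGateauxGradientAt (f : H → EReal) (g x : H) : Prop :=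
  x ∈ interior (dom f) ∧
    ∀ v : H, HasLineDerivAt ℝ (fun z => (f z).toReal) (inner ℝ g v) x v

/-- `f` is Gâteaux differentiable at the point `x` of `int dom f`. -/
def GateauxDifferentiableAt (f : H → EReal) (x : H) : Prop :=
  ∃ g : H, HasGateauxGradientAt f g x

open Classical in
/-- The gradient `∇f(x)` (with value `0` where `f` is not Gâteaux differentiable). -/
noncomputable def grad (f : H → EReal) (x : H) : H :=
  if h : GateauxDifferentiableAt f x then h.choose else 0

/-- Essential smoothness. -/
structure EssentiallySmooth (f : H → EReal) : Prop where
  opDom_subdifferential : opDom (subdifferential f) = interior (dom f)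
  interior_nonempty : (interior (dom f)).Nonempty
  gateauxDifferentiableAt : ∀ x ∈ interior (dom f), GateauxDifferentiableAt f x
  tendsto_norm_grad : ∀ (x : ℕ → H) (a : H), (∀ k, x k ∈ interior (dom f)) →
    a ∈ frontier (dom f) → Filter.Tendsto x Filter.atTop (nhds a) →
    Filter.Tendsto (fun k => ‖grad f (x k)‖) Filter.atTop Filter.atTop

/-- Essential strict convexity. On `dom ∂f ⊆ dom f` a proper function is real-valued. -/
structure EssentiallyStrictlyConvex (f : H → EReal) : Prop where
  locallyBoundedAt : ∀ u ∈ opDom (opInv (subdifferential f)),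
    LocallyBoundedAt (opInv (subdifferential f)) u
  strictConvexOn : ∀ C : Set H, Convex ℝ C → C ⊆ opDom (subdifferential f) →
    StrictConvexOn ℝ C (fun x => (f x).toReal)

/-- A function in `Γ₀(H)` is Legendre if it is essentially smooth and essentially strictly
convex. -/
structure IsLegendre (f : H → EReal) : Prop where
  isGammaZero : IsGammaZero f
  essentiallySmooth : EssentiallySmooth f
  essentiallyStrictlyConvex : EssentiallyStrictlyConvex f

open Classical in
/-- The Bregman distance `D_f(x, y)`. -/
noncomputable def bregmanDist (f : H → EReal) (x y : H) : EReal :=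
  if y ∈ interior (dom f) then f x - f y - ((inner ℝ (grad f y) (x - y) : ℝ) : EReal) else ⊤

/-- The points `q` of `int dom f` for which `{D_f(x, q) : x ∈ K}` is a singleton, that is, which
are Bregman equidistant from all points of `K` (`K` a nonempty finite subset of `dom f`). -/
def forwardEquidistant (f : H → EReal) (K : Set H) : Set H :=
  {q | q ∈ interior (dom f) ∧ ∃ c : EReal, (fun x => bregmanDist f x q) '' K = {c}}

/-- The image of a set under the partially defined map `∇f`. -/
def gradImage (f : H → EReal) (C : Set H) : Set H :=
  {y | ∃ z ∈ C, HasGateauxGradientAt f y z}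

/-- The forward Bregman pseudo-circumcenter set of `K`, namely `∇f*(aff K) ∩ E_f(K)` with `E_f(K)`
the set of points that are forward equidistant from `K`. -/
def forwardPseudoCircumcenter (f : H → EReal) (K : Set H) : Set H :=
  gradImage (conjugate f) (affineSpan ℝ K : Set H) ∩ forwardEquidistant f K

end Bregman

/-!
Let `z` be an interior point of `dom f*`. Finiteness of `f*` around `z` makes the sublevel sets of
`f - ⟨·, z⟩` bounded (Banach–Steinhaus), and nested bounded closed convex sets in a Hilbert space
have a common point, so `f - ⟨·, z⟩` has a minimizer `x`, that is, `z ∈ ∂f(x)`. Strict convexity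
makes it unique, and applying the same compactness on half-spaces shows that near-minimizers `y`
satisfy `⟨y, v⟩ ≈ ⟨x, v⟩` for every direction `v`, which is Gâteaux differentiability of `f*` at `z`
with gradient `x` (`Bregman.hasGateauxGradientAt_conjugate`). Neither continuity of `f*` nor the
biconjugate theorem is needed. As `dom ∂f = int dom f` and `f` is Gâteaux differentiable there,
`q = ∇f*(z)` amounts to `q ∈ int dom f` together with `∇f(q) = z`.

Equidistance of `q` from `p₀, …, pₘ` is the linear system `⟨∇f(q), pᵢ - p₀⟩ = f(pᵢ) - f(p₀)`
(`Bregman.mem_forwardEquidistant_range_iff`). Hence the pseudo-circumcenters are the points `∇f*(z)`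
for those `z` in the affine hull that solve this system. In the coordinates of `z` with respect to
the vectors `pᵢ - p₀` its matrix is their Gram matrix, which is invertible by affine independence,
so there is exactly one such `z` (`Bregman.inner_add_sum_smul_eq_iff`).
-/

namespace Bregman

variable {H : Type*} [NormedAddCommGroup H] [InnerProductSpace ℝ H]

/-! ### Nested convex sets in a Hilbert space -/

/-- The points of minimal norm form a Cauchy sequence, by the parallelogram law. -/
theorem nonempty_iInter_of_antitone_convex [CompleteSpace H] {C : ℕ → Set H} (hanti : Antitone C)
    (hclosed : ∀ n, IsClosed (C n)) (hconv : ∀ n, Convex ℝ (C n)) (hne : ∀ n, (C n).Nonempty)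
    (hbdd : Bornology.IsBounded (C 0)) : (⋂ n, C n).Nonempty := by
  have hmin : ∀ n, ∃ x ∈ C n, ∀ y ∈ C n, ‖x‖ ≤ ‖y‖ := by
    intro n
    obtain ⟨x, hx, hxmin⟩ := exists_norm_eq_iInf_of_complete_convex (hne n)
      (hclosed n).isComplete (hconv n) 0
    refine ⟨x, hx, fun y hy => ?_⟩
    have := ciInf_le (f := fun w : C n => ‖(0 : H) - w‖)
      ⟨0, by rintro _ ⟨w, rfl⟩; positivity⟩ ⟨y, hy⟩
    rw [← hxmin] at this
    simpa using this
  choose x hx hxmin using hmin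
  have hmono : Monotone fun n => ‖x n‖ := fun n k h => hxmin n _ (hanti h (hx k))
  obtain ⟨R, hR⟩ := hbdd.exists_norm_le
  have hbound : ∀ n, ‖x n‖ ≤ R := fun n => hR _ (hanti (Nat.zero_le n) (hx n))
  obtain ⟨L, hL⟩ : ∃ L, Filter.Tendsto (fun n => ‖x n‖) Filter.atTop (nhds L) :=
    ⟨_, tendsto_atTop_ciSup hmono ⟨R, by rintro _ ⟨n, rfl⟩; exact hbound n⟩⟩
  have hle : ∀ n, ‖x n‖ ≤ L := fun n => hmono.ge_of_tendsto hL n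
  have hcauchy : CauchySeq x := by
    refine cauchySeq_of_le_tendsto_0' (fun n => √(2 * (L ^ 2 - ‖x n‖ ^ 2))) ?_ ?_
    · intro n k hnk
      have hmid : (1 / 2 : ℝ) • x n + (1 / 2 : ℝ) • x k ∈ C n :=
        hconv n (hx n) (hanti hnk (hx k)) (by norm_num) (by norm_num) (by norm_num)
      have h1 := hxmin n _ hmid
      rw [← smul_add, norm_smul] at h1
      norm_num at h1
      have h2 := parallelogram_law_with_norm ℝ (x n) (x k)
      have h3 := hle k
      rw [dist_eq_norm]
      apply Real.le_sqrt_of_sq_le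
      nlinarith [norm_nonneg (x n), norm_nonneg (x k)]
    · have h1 : Filter.Tendsto (fun n => √(2 * (L ^ 2 - ‖x n‖ ^ 2))) Filter.atTop
          (nhds (√(2 * (L ^ 2 - L ^ 2)))) :=
        (((hL.pow 2).const_sub _).const_mul 2).sqrt
      simpa using h1
  obtain ⟨a, ha⟩ := cauchySeq_tendsto_of_complete hcauchy
  refine ⟨a, Set.mem_iInter.2 fun n => (hclosed n).mem_of_tendsto ha ?_⟩
  filter_upwards [Filter.eventually_ge_atTop n] with k hk using hanti hk (hx k)

/-! ### Conjugates and subgradients -/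

theorem IsGammaZero.coe_toReal {f : H → EReal} (hf : IsGammaZero f) {x : H} (hx : x ∈ dom f) :
    (((f x).toReal : ℝ) : EReal) = f x :=
  EReal.coe_toReal (ne_of_lt hx) (hf.ne_bot x)

theorem conjugate_le_coe_iff (f : H → EReal) (u : H) (r : ℝ) :
    conjugate f u ≤ r ↔ ∀ y, ((inner ℝ y u - r : ℝ) : EReal) ≤ f y := by
  rw [conjugate, iSup_le_iff]
  refine forall_congr' fun y => ?_
  induction hy : f y using EReal.rec with
  | bot => simp [-EReal.coe_sub]
  | top => simp
  | coe a =>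
    norm_cast
    constructor <;> intro h <;> linarith

theorem IsGammaZero.conjugate_ne_bot {f : H → EReal} (hf : IsGammaZero f) (u : H) :
    conjugate f u ≠ ⊥ := by
  obtain ⟨x, hx⟩ := hf.dom_nonempty
  have h : ((inner ℝ x u : ℝ) : EReal) - f x ≤ conjugate f u :=
    le_iSup (fun x : H => ((inner ℝ x u : ℝ) : EReal) - f x) x
  rw [← hf.coe_toReal hx, ← EReal.coe_sub] at h
  exact fun hb => EReal.coe_ne_bot _ (le_bot_iff.1 (hb ▸ h))

theorem IsGammaZero.exists_conjugate_eq_coe {f : H → EReal} (hf : IsGammaZero f) {u : H}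
    (hu : u ∈ dom (conjugate f)) : ∃ M : ℝ, conjugate f u = M :=
  ⟨_, (EReal.coe_toReal (ne_of_lt hu) (hf.conjugate_ne_bot u)).symm⟩

/-- The equality case of the Fenchel–Young inequality. -/
theorem mem_subdifferential_iff_le {f : H → EReal} {u : H} {M : ℝ} (hM : conjugate f u = M)
    {x : H} (hx : f x ≠ ⊥) :
    u ∈ subdifferential f x ∧ x ∈ dom f ↔ f x ≤ ((inner ℝ x u - M : ℝ) : EReal) := by
  induction hfx : f x using EReal.rec with
  | bot => exact absurd hfx hx
  | top => simp [dom, hfx, -EReal.coe_sub]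
  | coe a =>
    have hdom : x ∈ dom f := by simp [dom, hfx]
    have h1 : u ∈ subdifferential f x ↔ conjugate f u ≤ ((inner ℝ x u - a : ℝ) : EReal) := by
      rw [conjugate_le_coe_iff]
      refine forall_congr' fun y => ?_
      rw [hfx, ← EReal.coe_add, inner_sub_left]
      rw [show inner ℝ y u - (inner ℝ x u - a) = inner ℝ y u - inner ℝ x u + a by ring]
    rw [h1, hM, EReal.coe_le_coe_iff, EReal.coe_le_coe_iff]
    exact ⟨fun h => by linarith [h.1], fun h => ⟨by linarith, hdom⟩⟩

/-! ### Sublevel sets of a tilted function -/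

theorem IsGammaZero.isClosed_tilted_sublevel {f : H → EReal} (hf : IsGammaZero f) (z : H) (r : ℝ) :
    IsClosed {y | f y ≤ ((inner ℝ y z + r : ℝ) : EReal)} :=
  hf.lowerSemicontinuous.isClosed_epigraph.preimage
    (f := fun y : H => (y, ((inner ℝ y z + r : ℝ) : EReal)))
    (continuous_id.prodMk (continuous_coe_real_ereal.comp (by fun_prop)))

theorem IsGammaZero.convex_tilted_sublevel {f : H → EReal} (hf : IsGammaZero f) (z : H) (r : ℝ) :
    Convex ℝ {y | f y ≤ ((inner ℝ y z + r : ℝ) : EReal)} := by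
  intro x hx y hy a b ha hb hab
  have h := hf.convex_epigraph (x := (x, inner ℝ x z + r)) hx (y := (y, inner ℝ y z + r)) hy
    ha hb hab
  have heq : a * (inner ℝ x z + r) + b * (inner ℝ y z + r)
      = inner ℝ (a • x + b • y) z + r := by
    rw [inner_add_left, real_inner_smul_left, real_inner_smul_left]
    linear_combination r * hab
  simpa [-EReal.coe_add, -EReal.coe_mul, heq] using h

theorem exists_pos_add_smul_mem {s : Set H} {z : H} (hz : z ∈ interior s) (v : H) :
    ∃ t : ℝ, 0 < t ∧ z + t • v ∈ s := by
  have hcont : Filter.Tendsto (fun t : ℝ => z + t • v) (nhdsWithin 0 (Set.Ioi 0)) (nhds z) := by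
    have : Continuous fun t : ℝ => z + t • v := by fun_prop
    simpa using (this.tendsto 0).mono_left nhdsWithin_le_nhds
  obtain ⟨t, ht, ht0⟩ := ((hcont.eventually (mem_interior_iff_mem_nhds.1 hz)).and
    self_mem_nhdsWithin).exists
  exact ⟨t, ht0, ht⟩

/-- Finiteness of `f*` around `z` bounds the sublevel set weakly, hence in norm by the
Banach–Steinhaus theorem. -/
theorem IsGammaZero.isBounded_tilted_sublevel [CompleteSpace H] {f : H → EReal}
    (hf : IsGammaZero f) {z : H} (hz : z ∈ interior (dom (conjugate f))) (r : ℝ) :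
    Bornology.IsBounded {y | f y ≤ ((inner ℝ y z + r : ℝ) : EReal)} := by
  set S := {y | f y ≤ ((inner ℝ y z + r : ℝ) : EReal)}
  have hupper : ∀ v : H, ∃ C : ℝ, ∀ y ∈ S, inner ℝ y v ≤ C := by
    intro v
    obtain ⟨t, ht, hzt⟩ := exists_pos_add_smul_mem hz v
    obtain ⟨M, hM⟩ := hf.exists_conjugate_eq_coe hzt
    refine ⟨(M + r) / t, fun y hy => ?_⟩
    have h := EReal.coe_le_coe_iff.1 (((conjugate_le_coe_iff f _ M).1 hM.le y).trans hy)
    rw [inner_add_right, inner_smul_right] at h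
    rw [le_div_iff₀ ht]
    linarith
  obtain ⟨C, hC⟩ := banach_steinhaus (g := fun y : S => innerSL ℝ (y : H)) (fun v => by
    obtain ⟨C₁, h₁⟩ := hupper v
    obtain ⟨C₂, h₂⟩ := hupper (-v)
    refine ⟨max C₁ C₂, fun y => ?_⟩
    have h₂' := h₂ y y.2
    rw [inner_neg_right] at h₂'
    rw [innerSL_apply_apply, Real.norm_eq_abs, abs_le]
    constructor
    · linarith [le_max_right C₁ C₂]
    · exact (h₁ y y.2).trans (le_max_left _ _))
  refine isBounded_iff_forall_norm_le.2 ⟨C, fun y hy => ?_⟩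
  simpa using hC ⟨y, hy⟩

/-- Exact minimizers from approximate ones, under a half-space constraint: a substitute for weak
sequential compactness. -/
theorem IsGammaZero.exists_le_of_forall_exists_le_add [CompleteSpace H] {f : H → EReal}
    (hf : IsGammaZero f) {z : H} (hz : z ∈ interior (dom (conjugate f))) (M : ℝ) (v : H) (c : ℝ)
    (h : ∀ δ : ℝ, 0 < δ → ∃ y, f y ≤ ((inner ℝ y z + (-M + δ) : ℝ) : EReal) ∧ c ≤ inner ℝ y v) :
    ∃ y, f y ≤ ((inner ℝ y z - M : ℝ) : EReal) ∧ c ≤ inner ℝ y v := by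
  let δ : ℕ → ℝ := fun n => 1 / ((n : ℝ) + 1)
  let C : ℕ → Set H := fun n =>
    {y | f y ≤ ((inner ℝ y z + (-M + δ n) : ℝ) : EReal)} ∩ {y | c ≤ inner ℝ y v}
  have hδ : Filter.Tendsto δ Filter.atTop (nhds 0) := tendsto_one_div_add_atTop_nhds_zero_nat
  have hhalf : {y : H | c ≤ inner ℝ y v} = {y | c ≤ innerSL ℝ v y} := by
    ext y; simp [real_inner_comm]
  have hne : (⋂ n, C n).Nonempty := by
    refine nonempty_iInter_of_antitone_convex ?_ ?_ ?_ ?_ ?_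
    · intro n k hnk y hy
      refine ⟨hy.1.trans (EReal.coe_le_coe_iff.2 ?_), hy.2⟩
      have : δ k ≤ δ n := Nat.one_div_le_one_div hnk
      linarith
    · intro n
      exact (hf.isClosed_tilted_sublevel z _).inter (isClosed_le continuous_const (by fun_prop))
    · intro n
      refine (hf.convex_tilted_sublevel z _).inter ?_
      rw [hhalf]
      exact convex_halfSpace_ge (innerSL ℝ v).toLinearMap.isLinear c
    · intro n
      obtain ⟨y, hy⟩ := h (δ n) Nat.one_div_pos_of_nat
      exact ⟨y, hy⟩
    · exact (hf.isBounded_tilted_sublevel hz _).subset Set.inter_subset_left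
  obtain ⟨y, hy⟩ := hne
  rw [Set.mem_iInter] at hy
  refine ⟨y, ?_, (hy 0).2⟩
  have hlim : Filter.Tendsto (fun n => ((inner ℝ y z + (-M + δ n) : ℝ) : EReal)) Filter.atTop
      (nhds ((inner ℝ y z - M : ℝ) : EReal)) := by
    refine continuous_coe_real_ereal.continuousAt.tendsto.comp ?_
    simpa [sub_eq_add_neg] using (hδ.const_add (-M)).const_add (inner ℝ y z)
  exact ge_of_tendsto' hlim fun n => (hy n).1

/-! ### The gradient of the conjugate -/

theorem IsGammaZero.exists_mem_subdifferential [CompleteSpace H] {f : H → EReal}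
    (hf : IsGammaZero f) {z : H} (hz : z ∈ interior (dom (conjugate f))) :
    ∃ x ∈ dom f, z ∈ subdifferential f x := by
  obtain ⟨M, hM⟩ := hf.exists_conjugate_eq_coe (interior_subset hz)
  obtain ⟨x, hx, -⟩ := hf.exists_le_of_forall_exists_le_add hz M 0 0 (by
    intro δ hδ
    by_contra! hcon
    have h : conjugate f z ≤ ((M - δ : ℝ) : EReal) := by
      rw [conjugate_le_coe_iff]
      intro y
      by_contra! hy
      have h0 := hcon y (hy.le.trans (EReal.coe_le_coe_iff.2 (by linarith)))
      simp at h0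
    rw [hM, EReal.coe_le_coe_iff] at h
    linarith)
  have := (mem_subdifferential_iff_le hM (hf.ne_bot x)).2 hx
  exact ⟨x, this.2, this.1⟩

/-- The set `(∂f)⁻¹(z)` is convex and `f` is affine on it, so strict convexity leaves room for one
point only. -/
theorem eq_of_mem_subdifferential {f : H → EReal} (hf : IsGammaZero f)
    (hsc : EssentiallyStrictlyConvex f) {z x y : H} (hz : z ∈ dom (conjugate f))
    (hx : x ∈ dom f) (hzx : z ∈ subdifferential f x)
    (hy : y ∈ dom f) (hzy : z ∈ subdifferential f y) : x = y := by
  obtain ⟨M, hM⟩ := hf.exists_conjugate_eq_coe hz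
  have hmem := fun w => mem_subdifferential_iff_le hM (hf.ne_bot w)
  have hconv := hf.convex_tilted_sublevel z (-M)
  simp only [← sub_eq_add_neg] at hconv
  set C := {w | f w ≤ ((inner ℝ w z - M : ℝ) : EReal)}
  have hval : ∀ w ∈ C, (f w).toReal = inner ℝ w z - M := by
    intro w hw
    have : f w = ((inner ℝ w z - M : ℝ) : EReal) :=
      le_antisymm hw ((conjugate_le_coe_iff f z M).1 hM.le w)
    rw [this, EReal.toReal_coe]
  have hstrict := hsc.strictConvexOn C hconv fun w hw => ⟨z, ((hmem w).2 hw).1⟩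
  by_contra hne
  have hxC : x ∈ C := (hmem x).1 ⟨hzx, hx⟩
  have hyC : y ∈ C := (hmem y).1 ⟨hzy, hy⟩
  have hlt := hstrict.2 hxC hyC hne (by norm_num : (0 : ℝ) < 1 / 2)
    (by norm_num : (0 : ℝ) < 1 / 2) (by norm_num)
  simp only at hlt
  rw [hval x hxC, hval y hyC, hval _ (hconv hxC hyC (by norm_num) (by norm_num) (by norm_num)),
    inner_add_left, real_inner_smul_left, real_inner_smul_left, smul_eq_mul, smul_eq_mul] at hlt
  linarith

/-- The upper half of the one-sided directional derivative of `f*`: points `y` with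
`⟨y, v⟩ > ⟨x, v⟩ + ε` are too far from being maximizers at `z` to matter at `z + t v`. -/
theorem conjugate_add_smul_le [CompleteSpace H] {f : H → EReal} (hf : IsGammaZero f)
    (hsc : EssentiallyStrictlyConvex f) {z x : H} (hz : z ∈ interior (dom (conjugate f)))
    (hx : x ∈ dom f) (hzx : z ∈ subdifferential f x) {M : ℝ} (hM : conjugate f z = M)
    (v : H) {ε : ℝ} (hε : 0 < ε) :
    ∃ t₁ : ℝ, 0 < t₁ ∧ ∀ t, 0 ≤ t → t ≤ t₁ →
      conjugate f (z + t • v) ≤ ((M + t * (inner ℝ x v + ε) : ℝ) : EReal) := by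
  obtain ⟨δ, hδ, hgap⟩ : ∃ δ : ℝ, 0 < δ ∧ ∀ y, inner ℝ x v + ε ≤ inner ℝ y v →
      ((inner ℝ y z + (-M + δ) : ℝ) : EReal) ≤ f y := by
    by_contra! hcon
    obtain ⟨y, hy, hyv⟩ := hf.exists_le_of_forall_exists_le_add hz M v (inner ℝ x v + ε)
      fun δ hδ => (hcon δ hδ).imp fun y hy => ⟨hy.2.le, hy.1⟩
    obtain ⟨hzy, hyd⟩ := (mem_subdifferential_iff_le hM (hf.ne_bot y)).2 hy
    rw [eq_of_mem_subdifferential hf hsc (interior_subset hz) hx hzx hyd hzy] at hyv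
    linarith
  obtain ⟨t₀, ht₀, hzt⟩ := exists_pos_add_smul_mem hz v
  obtain ⟨M₁, hM₁⟩ := hf.exists_conjugate_eq_coe hzt
  set c := inner ℝ x v + ε
  set K := |M₁ - M + δ - t₀ * c| + 1 with hK
  have hKpos : 0 < K := by positivity
  refine ⟨min t₀ (t₀ * (δ / K)), by positivity, fun t ht htle => ?_⟩
  rw [conjugate_le_coe_iff]
  intro y
  have hA := (conjugate_le_coe_iff f z M).1 hM.le y
  have hB := (conjugate_le_coe_iff f _ M₁).1 hM₁.le y
  have hC := hgap y
  induction hfy : f y using EReal.rec with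
  | bot => exact absurd hfy (hf.ne_bot y)
  | top => exact le_top
  | coe a =>
    rw [hfy, EReal.coe_le_coe_iff] at hA hB
    rw [hfy, EReal.coe_le_coe_iff] at hC
    rw [EReal.coe_le_coe_iff]
    rw [inner_add_right, inner_smul_right] at hB ⊢
    rcases le_total (inner ℝ y v) c with hyc | hyc
    · nlinarith [mul_le_mul_of_nonneg_left hyc ht]
    · have hC := hC hyc
      -- Interpolate between the bounds at `z` and at `z + t₀ v`, with parameter `s = t / t₀`.
      obtain ⟨s, rfl⟩ : ∃ s, t = t₀ * s := ⟨t / t₀, by field_simp⟩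
      have hs : 0 ≤ s := nonneg_of_mul_nonneg_right ht ht₀
      have hs1 : s ≤ 1 := by
        have := htle.trans (min_le_left _ _)
        nlinarith
      have hs2 : s * K ≤ δ := by
        rw [← le_div_iff₀ hKpos]
        exact le_of_mul_le_mul_left (htle.trans (min_le_right _ _)) ht₀
      have hs3 : s * (M₁ - M + δ - t₀ * c) ≤ s * K :=
        mul_le_mul_of_nonneg_left ((le_abs_self _).trans (by linarith)) hs
      have h1 := mul_le_mul_of_nonneg_left hC (sub_nonneg.2 hs1)
      have h2 := mul_le_mul_of_nonneg_left hB hs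
      linarith

/-- The inverse of `∂f` is the gradient of `f*` on the interior of `dom f*`. -/
theorem hasGateauxGradientAt_conjugate [CompleteSpace H] {f : H → EReal} (hf : IsGammaZero f)
    (hsc : EssentiallyStrictlyConvex f) {z x : H} (hz : z ∈ interior (dom (conjugate f)))
    (hx : x ∈ dom f) (hzx : z ∈ subdifferential f x) :
    HasGateauxGradientAt (conjugate f) x z := by
  refine ⟨hz, fun v => ?_⟩
  obtain ⟨M, hM⟩ := hf.exists_conjugate_eq_coe (interior_subset hz)
  have hfx := (mem_subdifferential_iff_le hM (hf.ne_bot x)).1 ⟨hzx, hx⟩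
  have hlower : ∀ (w : H) (r : ℝ), conjugate f (z + w) ≤ r → M + inner ℝ x w ≤ r := by
    intro w r hr
    have h := EReal.coe_le_coe_iff.1 (((conjugate_le_coe_iff f _ r).1 hr x).trans hfx)
    rw [inner_add_right] at h
    linarith
  have hupper : ∀ w : H, ∀ ε > 0, ∃ t₁ : ℝ, 0 < t₁ ∧ ∀ t, 0 ≤ t → t ≤ t₁ →
      |(conjugate f (z + t • w)).toReal - M - t * inner ℝ x w| ≤ ε * t := by
    intro w ε hε
    obtain ⟨t₁, ht₁, h⟩ := conjugate_add_smul_le hf hsc hz hx hzx hM w hε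
    refine ⟨t₁, ht₁, fun t ht htle => ?_⟩
    have hle := h t ht htle
    obtain ⟨N, hN⟩ := hf.exists_conjugate_eq_coe (lt_of_le_of_lt hle (EReal.coe_lt_top _))
    have h1 := hlower _ _ hN.le
    rw [hN, EReal.coe_le_coe_iff] at hle
    rw [inner_smul_right] at h1
    rw [hN, EReal.toReal_coe, abs_le]
    constructor <;> nlinarith
  rw [HasLineDerivAt, hasDerivAt_iff_isLittleO, Asymptotics.isLittleO_iff]
  intro ε hε
  obtain ⟨t₁, ht₁, h₁⟩ := hupper v ε hε
  obtain ⟨t₂, ht₂, h₂⟩ := hupper (-v) ε hε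
  filter_upwards [Ioo_mem_nhds (neg_lt_zero.2 ht₂) ht₁] with t ht
  simp only [zero_smul, add_zero, sub_zero, hM, EReal.toReal_coe, smul_eq_mul, Real.norm_eq_abs]
  rcases le_total 0 t with h0 | h0
  · rw [abs_of_nonneg h0]
    exact h₁ t h0 ht.2.le
  · rw [abs_of_nonpos h0]
    have := h₂ (-t) (by linarith) (by linarith [ht.1])
    simpa [neg_smul_neg, inner_neg_right] using this

/-! ### Gâteaux gradients -/

theorem HasGateauxGradientAt.unique {f : H → EReal} {g g' x : H}
    (h : HasGateauxGradientAt f g x) (h' : HasGateauxGradientAt f g' x) : g = g' :=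
  ext_inner_right ℝ fun v => (h.2 v).unique (h'.2 v)

theorem HasGateauxGradientAt.grad_eq {f : H → EReal} {g x : H}
    (h : HasGateauxGradientAt f g x) : grad f x = g := by
  have hd : GateauxDifferentiableAt f x := ⟨g, h⟩
  rw [grad, dif_pos hd]
  exact hd.choose_spec.unique h

/-- Along every line through `x` the function `f - ⟨u, ·⟩` has a minimum at `x`, so its derivative
vanishes there. -/
theorem HasGateauxGradientAt.eq_of_mem_subdifferential {f : H → EReal} (hbot : ∀ x, f x ≠ ⊥)
    {g x u : H} (h : HasGateauxGradientAt f g x) (hu : u ∈ subdifferential f x) : u = g := by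
  refine ext_inner_right ℝ fun v => ?_
  have hder : HasDerivAt (fun t : ℝ => (f (x + t • v)).toReal - t * inner ℝ u v)
      (inner ℝ g v - 1 * inner ℝ u v) 0 :=
    (h.2 v : HasDerivAt _ _ _).sub ((hasDerivAt_id (0 : ℝ)).mul_const (inner ℝ u v))
  have hmin : IsLocalMin (fun t : ℝ => (f (x + t • v)).toReal - t * inner ℝ u v) 0 := by
    have hcont : Filter.Tendsto (fun t : ℝ => x + t • v) (nhds 0) (nhds x) := by
      have : Continuous fun t : ℝ => x + t • v := by fun_prop
      simpa using this.tendsto 0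
    filter_upwards [hcont.eventually (mem_interior_iff_mem_nhds.1 h.1)] with t ht
    have hsub := hu (x + t • v)
    rw [← EReal.coe_toReal (ne_of_lt (show x + t • v ∈ dom f from ht)) (hbot _),
      ← EReal.coe_toReal (ne_of_lt (show x ∈ dom f from interior_subset h.1)) (hbot x), ← EReal.coe_add,
      EReal.coe_le_coe_iff, add_sub_cancel_left, real_inner_smul_left, real_inner_comm] at hsub
    simp only [zero_smul, add_zero, zero_mul, sub_zero]
    linarith
  have := hmin.hasDerivAt_eq_zero hder
  linarith

/-! ### Legendre functions -/

/-- `q = ∇f*(z)` exactly when `z ∈ ∂f(q)`, for `z` in the interior of `dom f*`. -/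
theorem IsLegendre.hasGateauxGradientAt_conjugate_iff [CompleteSpace H] {f : H → EReal}
    (hf : IsLegendre f) {z q : H} (hz : z ∈ interior (dom (conjugate f))) :
    HasGateauxGradientAt (conjugate f) q z ↔ q ∈ interior (dom f) ∧ z ∈ subdifferential f q := by
  have hΓ := hf.isGammaZero
  have hsc := hf.essentiallyStrictlyConvex
  constructor
  · intro hq
    obtain ⟨x, hx, hzx⟩ := hΓ.exists_mem_subdifferential hz
    rw [hq.unique (hasGateauxGradientAt_conjugate hΓ hsc hz hx hzx)]
    exact ⟨hf.essentiallySmooth.opDom_subdifferential ▸ ⟨z, hzx⟩, hzx⟩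
  · rintro ⟨hq, hzq⟩
    exact hasGateauxGradientAt_conjugate hΓ hsc hz (interior_subset hq) hzq

theorem IsLegendre.grad_eq_of_mem_subdifferential {f : H → EReal} (hf : IsLegendre f) {q z : H}
    (hq : q ∈ interior (dom f)) (hz : z ∈ subdifferential f q) : grad f q = z := by
  obtain ⟨g, hg⟩ := hf.essentiallySmooth.gateauxDifferentiableAt q hq
  rw [hg.grad_eq, hg.eq_of_mem_subdifferential hf.isGammaZero.ne_bot hz]

/-! ### Equidistant points -/

theorem bregmanDist_eq_coe {f : H → EReal} (hf : IsGammaZero f) {x q : H} (hx : x ∈ dom f)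
    (hq : q ∈ interior (dom f)) :
    bregmanDist f x q
      = (((f x).toReal - (f q).toReal - inner ℝ (grad f q) (x - q) : ℝ) : EReal) := by
  rw [bregmanDist, if_pos hq, EReal.coe_sub, EReal.coe_sub, hf.coe_toReal hx,
    hf.coe_toReal (interior_subset hq)]

/-- The terms of `D_f(·, q)` that depend on `q` only cancel: equidistance is a linear condition on
`∇f(q)`. -/
theorem mem_forwardEquidistant_range_iff {f : H → EReal} (hf : IsGammaZero f) {m : ℕ}
    {p : Fin (m + 1) → H} (hp : ∀ i, p i ∈ dom f) {q : H} (hq : q ∈ interior (dom f)) :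
    q ∈ forwardEquidistant f (Set.range p) ↔ ∀ i : Fin m,
      inner ℝ (grad f q) (p i.succ - p 0) = (f (p i.succ)).toReal - (f (p 0)).toReal := by
  have hdist : ∀ i : Fin m, bregmanDist f (p i.succ) q = bregmanDist f (p 0) q ↔
      inner ℝ (grad f q) (p i.succ - p 0) = (f (p i.succ)).toReal - (f (p 0)).toReal := by
    intro i
    rw [bregmanDist_eq_coe hf (hp _) hq, bregmanDist_eq_coe hf (hp _) hq, EReal.coe_eq_coe_iff,
      inner_sub_right, inner_sub_right, inner_sub_right]
    constructor <;> intro h <;> linarith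
  simp_rw [← hdist]
  constructor
  · rintro ⟨-, c, hc⟩ i
    have h : ∀ j, bregmanDist f (p j) q = c := fun j =>
      (hc.subset ⟨p j, ⟨j, rfl⟩, rfl⟩ : bregmanDist f (p j) q ∈ ({c} : Set EReal))
    rw [h, h]
  · intro h
    refine ⟨hq, bregmanDist f (p 0) q, Set.eq_singleton_iff_unique_mem.2
      ⟨⟨p 0, ⟨0, rfl⟩, rfl⟩, ?_⟩⟩
    rintro _ ⟨_, ⟨j, rfl⟩, rfl⟩
    refine Fin.cases rfl (fun i => h i) j

/-! ### Points of an affine hull with prescribed inner products -/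

theorem mem_affineSpan_range_fin_succ_iff {m : ℕ} {p : Fin (m + 1) → H} {z : H} :
    z ∈ affineSpan ℝ (Set.range p) ↔
      ∃ β : Fin m → ℝ, z = p 0 + ∑ i, β i • (p i.succ - p 0) := by
  have h0 : p 0 ∈ affineSpan ℝ (Set.range p) := mem_affineSpan ℝ ⟨0, rfl⟩
  rw [← AffineSubspace.vsub_right_mem_direction_iff_mem h0, direction_affineSpan,
    vectorSpan_range_eq_span_range_vsub_right ℝ p 0, Submodule.mem_span_range_iff_exists_fun]
  constructor
  · rintro ⟨c, hc⟩
    refine ⟨fun i => c i.succ, ?_⟩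
    simp only [Fin.sum_univ_succ, vsub_eq_sub, sub_self, smul_zero, zero_add] at hc
    rw [hc]
    abel
  · rintro ⟨β, rfl⟩
    exact ⟨Fin.cons 0 β, by simp [Fin.sum_univ_succ]⟩

theorem isUnit_gram_of_linearIndependent {m : ℕ} {v : Fin m → H} (hv : LinearIndependent ℝ v) :
    IsUnit (Matrix.gram ℝ v) :=
  (Matrix.isUnit_iff_isUnit_det _).2
    (isUnit_iff_ne_zero.2 (Matrix.det_gram_ne_zero_iff_linearIndependent.2 hv))

/-- The points of `a + span v` with prescribed inner products against the `v i` are given by the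
solution of the Gram system. -/
theorem inner_add_sum_smul_eq_iff {m : ℕ} {v : Fin m → H} (hv : LinearIndependent ℝ v) (a : H)
    (η β : Fin m → ℝ) :
    (∀ i, inner ℝ (a + ∑ j, β j • v j) (v i) = η i) ↔
      β = (Matrix.gram ℝ v)⁻¹.mulVec fun i => η i - inner ℝ a (v i) := by
  have hdet := (Matrix.isUnit_iff_isUnit_det _).1 (isUnit_gram_of_linearIndependent hv)
  have h1 : (∀ i, inner ℝ (a + ∑ j, β j • v j) (v i) = η i) ↔
      (Matrix.gram ℝ v).mulVec β = fun i => η i - inner ℝ a (v i) := by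
    rw [funext_iff]
    refine forall_congr' fun i => ?_
    have h2 : (Matrix.gram ℝ v).mulVec β i = inner ℝ (∑ j, β j • v j) (v i) := by
      simp only [Matrix.mulVec, dotProduct, Matrix.gram_apply, sum_inner, real_inner_smul_left]
      exact Finset.sum_congr rfl fun j _ => by rw [mul_comm, real_inner_comm]
    rw [h2, inner_add_left]
    constructor <;> intro h <;> linarith
  rw [h1]
  constructor
  · intro h
    rw [← h, Matrix.mulVec_mulVec, Matrix.nonsing_inv_mul _ hdet, Matrix.one_mulVec]
  · rintro rfl
    rw [Matrix.mulVec_mulVec, Matrix.mul_nonsing_inv _ hdet, Matrix.one_mulVec]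

theorem linearIndependent_succ_sub_zero {m : ℕ} {p : Fin (m + 1) → H}
    (hind : AffineIndependent ℝ p) : LinearIndependent ℝ fun i : Fin m => p i.succ - p 0 :=
  ((affineIndependent_iff_linearIndependent_vsub ℝ p 0).1 hind).comp
    (fun i : Fin m => (⟨i.succ, Fin.succ_ne_zero i⟩ : {x : Fin (m + 1) // x ≠ 0}))
    fun _ _ h => Fin.succ_injective m (congrArg Subtype.val h)

end Bregman

theorem theorem4p11 {H : Type*} [NormedAddCommGroup H] [InnerProductSpace ℝ H] [CompleteSpace H]
    (f : H → EReal) (hf : Bregman.IsLegendre f)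
    (m : ℕ) (p : Fin (m + 1) → H) (hp : ∀ i, p i ∈ Bregman.dom f)
    (hind : AffineIndependent ℝ p)
    (haff : (affineSpan ℝ (Set.range p) : Set H) ⊆ interior (Bregman.dom (Bregman.conjugate f)))
    (η : Fin m → ℝ) (hη : ∀ i, η i = (f (p i.succ)).toReal - (f (p 0)).toReal)
    (α : Fin m → ℝ)
    (hα : α = (Matrix.gram ℝ (fun i : Fin m => p i.succ - p 0))⁻¹.mulVec
      (fun i => η i - inner ℝ (p 0) (p i.succ - p 0))) :
    IsUnit (Matrix.gram ℝ (fun i : Fin m => p i.succ - p 0)) ∧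
    Bregman.GateauxDifferentiableAt (Bregman.conjugate f)
      (p 0 + ∑ i : Fin m, α i • (p i.succ - p 0)) ∧
    (Bregman.forwardPseudoCircumcenter f (Set.range p)).Nonempty ∧
    Bregman.forwardPseudoCircumcenter f (Set.range p) =
      {Bregman.grad (Bregman.conjugate f) (p 0 + ∑ i : Fin m, α i • (p i.succ - p 0))} := by
  have hlin := Bregman.linearIndependent_succ_sub_zero hind
  set z := p 0 + ∑ i : Fin m, α i • (p i.succ - p 0) with hz_def
  have hz_aff : z ∈ affineSpan ℝ (Set.range p) :=
    Bregman.mem_affineSpan_range_fin_succ_iff.2 ⟨α, rfl⟩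
  have hz := haff hz_aff
  have hz_inner := (Bregman.inner_add_sum_smul_eq_iff hlin (p 0) η α).2 hα
  obtain ⟨x, hx_dom, hzx⟩ := hf.isGammaZero.exists_mem_subdifferential hz
  have hx_grad := Bregman.hasGateauxGradientAt_conjugate hf.isGammaZero
    hf.essentiallyStrictlyConvex hz hx_dom hzx
  obtain ⟨hx, -⟩ := (hf.hasGateauxGradientAt_conjugate_iff hz).1 hx_grad
  have hx_mem : x ∈ Bregman.forwardPseudoCircumcenter f (Set.range p) := by
    refine ⟨⟨z, hz_aff, hx_grad⟩,
      (Bregman.mem_forwardEquidistant_range_iff hf.isGammaZero hp hx).2 fun i => ?_⟩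
    rw [hf.grad_eq_of_mem_subdifferential hx hzx, ← hη]
    exact hz_inner i
  refine ⟨Bregman.isUnit_gram_of_linearIndependent hlin, ⟨x, hx_grad⟩, ⟨x, hx_mem⟩, ?_⟩
  rw [hx_grad.grad_eq]
  refine Set.eq_singleton_iff_unique_mem.2 ⟨hx_mem, ?_⟩
  rintro q ⟨⟨w, hw_aff, hq_grad⟩, hq_eq⟩
  obtain ⟨hq, hwq⟩ := (hf.hasGateauxGradientAt_conjugate_iff (haff hw_aff)).1 hq_grad
  have hq_inner := (Bregman.mem_forwardEquidistant_range_iff hf.isGammaZero hp hq).1 hq_eq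
  rw [hf.grad_eq_of_mem_subdifferential hq hwq] at hq_inner
  obtain ⟨β, rfl⟩ := Bregman.mem_affineSpan_range_fin_succ_iff.1 hw_aff
  have hβ := (Bregman.inner_add_sum_smul_eq_iff hlin (p 0) η β).1
    fun i => (hq_inner i).trans (hη i).symm
  rw [hβ.trans hα.symm] at hq_grad
  exact hq_grad.unique hx_grad
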